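/- Let $(\Omega,\mathscr{B},\mu)$ be a probability space and $T:\Omega\to\Omega$ a measure preserving map for which $\mu$ is ergodic. For a measurable set $B\subset\Omega$ with $\mu(B)>0$ let $\tau_B(x)=\min\{j\ge 1: T^jx\in B\}$ (with $\tau_B(x)=\infty$ if there is no such $j$) and $$F_B(t)=\mu\left(\left\{x\in\Omega:\tau_B(x)>\frac{t}{\mu(B)}\right\}\right),\qquad t>0.$$ Let $U\subset\Omega$ be measurable with $\mu(U)>0$, let $\hat T=T^{\tau_U}:U\to U$ be the induced map (defined almost everywhere on $U$), and let $\hat\mu(A)=\mu(A)/\mu(U)$, for measurable $A\subset U$, be the induced measure. For measurable $B\subset U$ with $\mu(B)>0$ let $\hat\tau_B(x)=\min\{j\ge1:\hat T^jx\in B\}$ (again $\infty$ if there is no such $j$) and $$\hat F_B(t)=\hat\mu\left(\left\{x\in U:\hat\tau_B(x)>\frac{t}{\hat\mu(B)}\right\}\right),\qquad t>0.$$ **Theorem.** Let $B_j\subset U$, $j\in\mathbb{N}$, be measurable sets with $\mu(B_j)>0$ and $\mu(B_j)\to0$ as $j\to\infty$. Then the limit $F(t)=\lim_{j\to\infty}F_{B_j}(t)$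 exists for every $t>0$ if and only if the limit $\hat F(t)=\lim_{j\to\infty}\hat F_{B_j}(t)$ exists for every $t>0$. Moreover, when these limits exist, $F(t)=\hat F(t)$ for all $t>0$. -/

import Mathlib

open MeasureTheory Filter Topology Set
open scoped ENNReal

noncomputable section

/-- The entry time `τ_B(x) = min {j ≥ 1 : T^j x ∈ B}` of the point `x` to the set `B`,
equal to `∞` (that is `⊤`) if no `T^j x` with `j ≥ 1` lies in `B`. -/
def entryTime {Ω : Type*} (T : Ω → Ω) (B : Set Ω) (x : Ω) : ℕ∞ :=
  ⨅ (j : ℕ) (_ : 1 ≤ j ∧ T^[j] x ∈ B), (j : ℕ∞)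

/-- The entry times distribution `F_B(t) = μ {x : τ_B(x) > t / μ(B)}` of the system
`(Ω, T, μ)`; it is meant for `t > 0` and `0 < μ(B) < ∞`. The comparison takes place in
`[0, ∞]`, because `τ_B` may be infinite. -/
def entryTimeDist {Ω : Type*} [MeasurableSpace Ω] (T : Ω → Ω) (μ : Measure Ω)
    (B : Set Ω) (t : ℝ) : ℝ :=
  μ.real {x | ENNReal.ofReal (t / μ.real B) < (entryTime T B x : ℝ≥0∞)}

/-- `T^{τ_U(x)} x` lies in `U` for `x ∈ U` (if `τ_U(x) = ∞` then `toNat` gives the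
exponent `0`). -/
theorem iterate_entryTime_mem {Ω : Type*} (T : Ω → Ω) (U : Set Ω) {x : Ω} (hx : x ∈ U) :
    T^[(entryTime T U x).toNat] x ∈ U := by
  classical
  by_cases h : ∃ j : ℕ, 1 ≤ j ∧ T^[j] x ∈ U
  · have he : entryTime T U x = (Nat.find h : ℕ∞) := by
      apply le_antisymm
      · exact iInf₂_le (Nat.find h) (Nat.find_spec h)
      · refine le_iInf₂ fun j hj => ?_
        exact_mod_cast Nat.find_min' h hj
    rw [he, ENat.toNat_natCast]
    exact (Nat.find_spec h).2
  · have he : entryTime T U x = ⊤ := by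
      simp only [entryTime, iInf_eq_top]
      exact fun j hj => absurd ⟨j, hj⟩ h
    rw [he, ENat.toNat_top]
    exact hx

/-- The induced map `T^{τ_U} : U → U`. Points of `U` that never return to `U`, where
`T^{τ_U}` is undefined (a null set when `T` preserves a finite measure), are left fixed. -/
def inducedMap {Ω : Type*} (T : Ω → Ω) (U : Set Ω) (x : U) : U :=
  ⟨T^[(entryTime T U (x : Ω)).toNat] (x : Ω), iterate_entryTime_mem T U x.2⟩

/-- The induced measure on `U`, with the value `μ(A) / μ(U)` at a measurable `A ⊆ U`. -/
def inducedMeasure {Ω : Type*} [MeasurableSpace Ω] (μ : Measure Ω) (U : Set Ω) :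
    Measure U :=
  (μ U)⁻¹ • μ.comap ((↑) : U → Ω)

/-- The entry times distribution of the induced system on `U` to a set `B ⊆ U`. -/
def inducedEntryTimeDist {Ω : Type*} [MeasurableSpace Ω] (T : Ω → Ω) (μ : Measure Ω)
    (U B : Set Ω) (t : ℝ) : ℝ :=
  entryTimeDist (inducedMap T U) (inducedMeasure μ U) (((↑) : U → Ω) ⁻¹' B) t

end

/-!
The two distributions are compared at the same sets `B = B_j`, and their difference is shown to
tend to `0` at every `t > 0`; both parts of the theorem follow at once.

Let `S_n(x)` be the number of `k ∈ {1, …, n}` with `T^k x ∈ U`. The points of `U` visited by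
`T x, …, T^n x` are exactly `T̂ x, …, T̂^{S_n(x)} x`, so for `x ∈ U` and `B ⊆ U`
the events `τ_B(x) > n` and `τ̂_B(x) > S_n(x)` coincide
(`natCast_lt_entryTime_iff_visitCount_lt`). By the mean ergodic theorem, `S_n / n → μ(U)` in
`L¹(μ)` (`tendsto_integral_abs_visitCount_div_sub`), hence in measure. Thus, with
`n = ⌊s / μ(B)⌋` and `m = ⌊t / μ̂(B)⌋`, outside a set of small measure `S_n < m` if `s < t`, and
`S_n > m` if `s > t`, which squeezes `F̂_B(t)` between values at `s` of the
distribution of `μ(B) τ_B` under the measure `μ̂`.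

Passing from `μ̂` to `μ` is asymptotically harmless
(`tendsto_measureReal_inter_sub_mul`): the event `V = {τ_B > n}` changes by at most
`μ(B)` under one step of `T`, so `μ(V ∩ U)` is within `K μ(B)` of the average of
`μ(V ∩ T^{-k} U)` over `1 ≤ k ≤ K`, and the mean ergodic theorem replaces that average
by `μ(V) μ(U)`, uniformly in `n`. Finally `F_B(s) - F_B(t) ≤ t - s + μ(B)` for `s ≤ t`
(`entryTimeDist_le_add`), so that `s` may be moved to `t`. Neither Kac's formula nor invariance
of `μ̂` under `T̂` is needed.
-/

section EntryTimes

variable {Ω : Type*}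

/-! ### Entry times and visits to `U` -/

theorem natCast_lt_entryTime_iff (T : Ω → Ω) (B : Set Ω) (x : Ω) (n : ℕ) :
    (n : ℕ∞) < entryTime T B x ↔ ∀ k < n, T^[k + 1] x ∉ B := by
  rw [← ENat.add_one_le_iff (ENat.natCast_ne_top n), entryTime, le_iInf₂_iff]
  constructor
  · intro h k hk hkB
    have := h (k + 1) ⟨by omega, hkB⟩
    norm_cast at this
    omega
  · rintro h j ⟨hj, hjB⟩
    by_contra! hlt
    norm_cast at hlt
    refine h (j - 1) (by omega) ?_
    rwa [Nat.sub_add_cancel hj]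

theorem ofReal_lt_entryTime_iff (T : Ω → Ω) (B : Set Ω) (x : Ω) {r : ℝ} (hr : 0 ≤ r) :
    ENNReal.ofReal r < (entryTime T B x : ℝ≥0∞) ↔ (⌊r⌋₊ : ℕ∞) < entryTime T B x := by
  cases h : entryTime T B x with
  | top => simp
  | coe k =>
    rw [ENat.toENNReal_coe, ← ENNReal.ofReal_natCast, ENNReal.ofReal_lt_ofReal_iff_of_nonneg hr,
      Nat.cast_lt, Nat.floor_lt hr]

/-- The number of `k ∈ {1, …, n}` with `T^k x ∈ U`, encoded as a Birkhoff sum started at `T x`,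
since entry times do not count time `0`. -/
noncomputable def visitCount (T : Ω → Ω) (U : Set Ω) (n : ℕ) (x : Ω) : ℕ :=
  birkhoffSum T (U.indicator 1) n (T x)

theorem visitCount_succ_of_mem {T : Ω → Ω} {U : Set Ω} {n : ℕ} {x : Ω} (h : T^[n + 1] x ∈ U) :
    visitCount T U (n + 1) x = visitCount T U n x + 1 := by
  rw [Function.iterate_succ_apply] at h
  simp [visitCount, birkhoffSum_succ, h]

theorem visitCount_succ_of_notMem {T : Ω → Ω} {U : Set Ω} {n : ℕ} {x : Ω}
    (h : T^[n + 1] x ∉ U) : visitCount T U (n + 1) x = visitCount T U n x := by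
  rw [Function.iterate_succ_apply] at h
  simp [visitCount, birkhoffSum_succ, h]

theorem visitCount_le (T : Ω → Ω) (U : Set Ω) (n : ℕ) (x : Ω) : visitCount T U n x ≤ n := by
  induction n with
  | zero => simp [visitCount]
  | succ n ih =>
    by_cases h : T^[n + 1] x ∈ U
    · rw [visitCount_succ_of_mem h]
      omega
    · rw [visitCount_succ_of_notMem h]
      omega

theorem visitCount_div_eq (T : Ω → Ω) (U : Set Ω) (n : ℕ) (x : Ω) :
    (visitCount T U n x : ℝ) / n = birkhoffAverage ℝ T (U.indicator 1) n (T x) := by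
  have h := map_birkhoffSum (Nat.castAddMonoidHom ℝ) T (U.indicator 1) n (T x)
  have h' : (Nat.castAddMonoidHom ℝ) ∘ U.indicator 1 = (U.indicator 1 : Ω → ℝ) := by
    ext y
    by_cases hy : y ∈ U <;> simp [hy]
  rw [h'] at h
  rw [birkhoffAverage, ← h, smul_eq_mul, div_eq_inv_mul]
  rfl

theorem inducedMap_eq_of_first_return {T : Ω → Ω} {U : Set Ω} {x : U} {n : ℕ}
    (hn : T^[n + 1] (x : Ω) ∈ U) (h : ∀ k < n, T^[k + 1] (x : Ω) ∉ U) :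
    (inducedMap T U x : Ω) = T^[n + 1] (x : Ω) := by
  have h₁ : (n : ℕ∞) < entryTime T U x := (natCast_lt_entryTime_iff T U x n).2 h
  have h₂ : ¬ ((n + 1 : ℕ) : ℕ∞) < entryTime T U x := fun h' =>
    (natCast_lt_entryTime_iff T U x (n + 1)).1 h' n (by omega) hn
  have h₃ : entryTime T U x = ((n + 1 : ℕ) : ℕ∞) := by
    refine le_antisymm (not_lt.1 h₂) ?_
    push_cast
    exact Order.add_one_le_of_lt h₁
  simp only [inducedMap, h₃, ENat.toNat_natCast]

/-- The iterate of the induced map whose exponent is the number of visits to `U` up to time `n`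
sits at the position `T^j x` of the last visit (`j = 0` if there was none). -/
theorem exists_iterate_inducedMap_eq (T : Ω → Ω) (U : Set Ω) (x : U) (n : ℕ) :
    ∃ j ≤ n, ((inducedMap T U)^[visitCount T U n x] x : Ω) = T^[j] (x : Ω) ∧
      ∀ i, j < i → i ≤ n → T^[i] (x : Ω) ∉ U := by
  induction n with
  | zero => exact ⟨0, le_rfl, by simp [visitCount], by omega⟩
  | succ n ih =>
    obtain ⟨j, hj, hjx, hout⟩ := ih
    by_cases h : T^[n + 1] (x : Ω) ∈ U
    · refine ⟨n + 1, le_rfl, ?_, by omega⟩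
      rw [visitCount_succ_of_mem h, Function.iterate_succ_apply']
      set y := (inducedMap T U)^[visitCount T U n x] x
      have hy : ∀ k, T^[k] (y : Ω) = T^[k + j] (x : Ω) := fun k => by
        rw [hjx, Function.iterate_add_apply]
      have hk : n - j + 1 + j = n + 1 := by omega
      rw [inducedMap_eq_of_first_return (n := n - j), hy, hk]
      · rwa [hy, hk]
      · intro k hk'
        rw [hy]
        exact hout _ (by omega) (by omega)
    · refine ⟨j, by omega, by rwa [visitCount_succ_of_notMem h], fun i hi hin => ?_⟩
      rcases Nat.lt_or_ge n i with h' | h'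
      · rwa [show i = n + 1 by omega]
      · exact hout i hi h'

theorem iterate_inducedMap_visitCount_succ {T : Ω → Ω} {U : Set Ω} {x : U} {n : ℕ}
    (h : T^[n + 1] (x : Ω) ∈ U) :
    ((inducedMap T U)^[visitCount T U n x + 1] x : Ω) = T^[n + 1] (x : Ω) := by
  obtain ⟨j, hj, hjx, hout⟩ := exists_iterate_inducedMap_eq T U x (n + 1)
  rw [← visitCount_succ_of_mem h, hjx]
  rcases hj.lt_or_eq with hlt | rfl
  · exact absurd h (hout _ hlt le_rfl)
  · rfl

/-- An orbit starting in `U` avoids `B ⊆ U` up to time `n` exactly if the induced orbit avoids `B`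
up to the number of visits to `U` by time `n`. -/
theorem natCast_lt_entryTime_iff_visitCount_lt {T : Ω → Ω} {U B : Set Ω} (hBU : B ⊆ U) (x : U)
    (n : ℕ) :
    (n : ℕ∞) < entryTime T B (x : Ω) ↔
      (visitCount T U n x : ℕ∞) < entryTime (inducedMap T U) (((↑) : U → Ω) ⁻¹' B) x := by
  simp only [natCast_lt_entryTime_iff, mem_preimage]
  induction n with
  | zero => simp [visitCount]
  | succ n ih =>
    rw [Nat.forall_lt_succ_right, ih]
    by_cases h : T^[n + 1] (x : Ω) ∈ U
    · rw [visitCount_succ_of_mem h, Nat.forall_lt_succ_right, iterate_inducedMap_visitCount_succ h]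
    · rw [visitCount_succ_of_notMem h]
      exact and_iff_left fun h' => h (hBU h')

variable [MeasurableSpace Ω] {μ : Measure Ω} {T : Ω → Ω}

/-! ### The mean ergodic theorem and visit frequencies -/

/-- Mean ergodic theorem in `L¹` for square integrable observables. Von Neumann's theorem for the
Koopman operator on `L²` gives convergence to an invariant function, which is constant by
ergodicity; the constant is the common integral of the Birkhoff averages. -/
theorem Ergodic.tendsto_integral_abs_birkhoffAverage_sub [IsProbabilityMeasure μ]
    (hT : Ergodic T μ) {f : Ω → ℝ} (hf : MemLp f 2 μ) :
    Tendsto (fun n => ∫ x, |birkhoffAverage ℝ T f n x - ∫ y, f y ∂μ| ∂μ) atTop (𝓝 0) := by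
  set P : Lp ℝ 2 μ →ₗᵢ[ℝ] Lp ℝ 2 μ := Lp.compMeasurePreservingₗᵢ ℝ T hT.toMeasurePreserving
  have hlim := P.toContinuousLinearMap.tendsto_birkhoffAverage_orthogonalProjection
    P.norm_toContinuousLinearMap_le (hf.toLp f)
  obtain ⟨g, hg, hlim⟩ : ∃ g : Lp ℝ 2 μ, P g = g ∧
      Tendsto (birkhoffAverage ℝ P id · (hf.toLp f)) atTop (𝓝 g) :=
    ⟨_, (P.toContinuousLinearMap.eqLocus (1 : Lp ℝ 2 μ →L[ℝ] Lp ℝ 2 μ)).orthogonalProjectionOnto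
      (hf.toLp f) |>.2, hlim⟩
  -- The limit is invariant, hence almost everywhere a constant `c`.
  obtain ⟨c, hc⟩ : ∃ c : ℝ, g =ᵐ[μ] Function.const Ω c := by
    refine hT.ae_eq_const_of_ae_eq_comp_ae (Lp.aestronglyMeasurable g) ?_
    have := Lp.coeFn_compMeasurePreserving g hT.toMeasurePreserving
    refine this.symm.trans (Eq.eventuallyEq ?_)
    exact congrArg (fun h : Lp ℝ 2 μ => (h : Ω → ℝ)) hg
  have hmp : ∀ n, MeasurePreserving T^[n] μ μ := hT.toMeasurePreserving.iterate
  have hsucc : ∀ n, birkhoffSum T f (n + 1) = birkhoffSum T f n + f ∘ T^[n] := fun n =>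
    funext (birkhoffSum_succ T f n)
  have hmemS : ∀ n, MemLp (birkhoffSum T f n) 2 μ := fun n => by
    induction n with
    | zero => simp
    | succ n ih =>
      rw [hsucc]
      exact ih.add (hf.comp_measurePreserving (hmp n))
  have hmem : ∀ n, MemLp (birkhoffAverage ℝ T f n) 2 μ := fun n =>
    (hmemS n).const_smul (n : ℝ)⁻¹
  have hrep : ∀ n, birkhoffAverage ℝ P id n (hf.toLp f) = (hmem n).toLp _ := fun n => by
    have hPk : ∀ k, P^[k] (hf.toLp f) = (hf.comp_measurePreserving (hmp k)).toLp _ := fun k =>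
      congrFun (Lp.compMeasurePreserving_iterate hT.toMeasurePreserving k) (hf.toLp f)
    have hsum : birkhoffSum P id n (hf.toLp f) = (hmemS n).toLp _ := by
      induction n with
      | zero => rfl
      | succ n ih =>
        rw [birkhoffSum_succ, ih, id, hPk, ← MemLp.toLp_add]
        exact MemLp.toLp_congr _ _ (.of_eq (hsucc n).symm)
    rw [birkhoffAverage, hsum, ← MemLp.toLp_const_smul]
    rfl
  have key : Tendsto (fun n => ∫ x, |birkhoffAverage ℝ T f n x - c| ∂μ) atTop (𝓝 0) := by
    have h0 := tendsto_iff_norm_sub_tendsto_zero.1 hlim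
    refine squeeze_zero (fun n => integral_nonneg fun x => abs_nonneg _) (fun n => ?_) h0
    have hm : MemLp (fun x => birkhoffAverage ℝ T f n x - c) 2 μ := (hmem n).sub (memLp_const c)
    have hg' : g = (memLp_const c).toLp _ := by
      rw [← Lp.toLp_coeFn g (Lp.memLp g)]
      exact (MemLp.toLp_eq_toLp_iff _ _).2 hc
    have h1 : birkhoffAverage ℝ P id n (hf.toLp f) - g = hm.toLp _ := by
      rw [hrep, hg', ← MemLp.toLp_sub]; rfl
    rw [h1, Lp.norm_toLp]
    have h2 := eLpNorm_le_eLpNorm_of_exponent_le (p := 1) (q := 2) one_le_two hm.1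
    refine le_trans (le_of_eq ?_) (ENNReal.toReal_mono hm.2.ne h2)
    rw [eLpNorm_one_eq_lintegral_enorm, ← integral_norm_eq_lintegral_enorm hm.1]
    rfl
  have hIA : ∀ n, Integrable (birkhoffAverage ℝ T f n) μ := fun n => (hmem n).integrable one_le_two
  have hmean : ∀ n, n ≠ 0 → ∫ x, birkhoffAverage ℝ T f n x ∂μ = ∫ x, f x ∂μ := by
    intro n hn
    have : ∀ k, ∫ x, f (T^[k] x) ∂μ = ∫ x, f x ∂μ := fun k => by
      have h := (hmp k).map_eq
      conv_rhs => rw [← h]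
      rw [integral_map (hmp k).aemeasurable (by rw [h]; exact hf.1)]
    simp only [birkhoffAverage, birkhoffSum, smul_eq_mul]
    rw [integral_const_mul, integral_finsetSum _ fun k _ => show Integrable (fun x => f (T^[k] x)) μ
      from (hf.comp_measurePreserving (hmp k)).integrable one_le_two]
    simp [this]
    field_simp
  -- Every Birkhoff average has integral `∫ f`, so the `L¹` limit `c` has it as well.
  have hc' : ∫ x, f x ∂μ = c := by
    have : |∫ x, f x ∂μ - c| ≤ 0 := by
      refine ge_of_tendsto key ?_
      filter_upwards [eventually_ne_atTop 0] with n hn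
      rw [← hmean n hn]
      calc _ = |∫ x, (birkhoffAverage ℝ T f n x - c) ∂μ| := by
            rw [integral_sub (hIA n) (integrable_const c)]; simp
        _ ≤ _ := abs_integral_le_integral_abs
    exact sub_eq_zero.1 (abs_nonpos_iff.1 this)
  rwa [hc']

theorem measurableSet_natCast_lt_entryTime (hT : Measurable T) {B : Set Ω} (hB : MeasurableSet B)
    (n : ℕ) : MeasurableSet {x | (n : ℕ∞) < entryTime T B x} := by
  simp only [natCast_lt_entryTime_iff, ofPred_forall]
  exact .iInter fun k => .iInter fun _ => (hT.iterate (k + 1)) hB.compl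

theorem measurable_visitCount (hT : Measurable T) {U : Set Ω} (hU : MeasurableSet U) (n : ℕ) :
    Measurable (visitCount T U n) := by
  unfold visitCount birkhoffSum
  exact Finset.measurable_fun_sum _ fun k _ =>
    ((measurable_one.indicator hU).comp (hT.iterate k)).comp hT

theorem tendsto_integral_abs_visitCount_div_sub [IsProbabilityMeasure μ] (hT : Ergodic T μ)
    {U : Set Ω} (hU : MeasurableSet U) :
    Tendsto (fun n => ∫ x, |(visitCount T U n x : ℝ) / n - μ.real U| ∂μ) atTop (𝓝 0) := by
  have hf : MemLp (U.indicator (1 : Ω → ℝ)) 2 μ := (memLp_const (1 : ℝ)).indicator hU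
  refine (hT.tendsto_integral_abs_birkhoffAverage_sub hf).congr fun n => ?_
  rw [integral_indicator_one hU]
  simp only [visitCount_div_eq]
  have hmeasS : Measurable (birkhoffSum T (U.indicator (1 : Ω → ℝ)) n) :=
    Finset.measurable_fun_sum _ fun k _ =>
      ((measurable_const (a := (1 : ℝ))).indicator hU).comp (hT.measurable.iterate k)
  have hmeas : Measurable (birkhoffAverage ℝ T (U.indicator (1 : Ω → ℝ)) n) :=
    hmeasS.const_smul (n : ℝ)⁻¹
  have h := integral_map (μ := μ) hT.measurable.aemeasurable
    (hmeas.sub_const (μ.real U)).abs.aestronglyMeasurable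
  rwa [hT.map_eq] at h

theorem integrable_visitCount_div_sub [IsProbabilityMeasure μ] (hT : Measurable T)
    {U : Set Ω} (hU : MeasurableSet U) (n : ℕ) (c : ℝ) :
    Integrable (fun x => (visitCount T U n x : ℝ) / n - c) μ := by
  refine Integrable.sub (Integrable.div_const (.of_bound (C := n) ?_ (ae_of_all _ fun x => ?_)) _)
    (integrable_const c)
  · exact (measurable_from_top.comp (measurable_visitCount hT hU n)).aestronglyMeasurable
  · simpa using visitCount_le T U n x

theorem tendsto_measureReal_le_abs_visitCount_div_sub [IsProbabilityMeasure μ] (hT : Ergodic T μ)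
    {U : Set Ω} (hU : MeasurableSet U) {δ : ℝ} (hδ : 0 < δ) :
    Tendsto (fun n => μ.real {x | δ ≤ |(visitCount T U n x : ℝ) / n - μ.real U|}) atTop (𝓝 0) := by
  have h := (tendsto_integral_abs_visitCount_div_sub hT hU).const_mul δ⁻¹
  rw [mul_zero] at h
  refine squeeze_zero (fun _ => measureReal_nonneg) (fun n => ?_) h
  rw [le_inv_mul_iff₀ hδ]
  exact mul_meas_ge_le_integral_of_nonneg (ae_of_all _ fun _ => abs_nonneg _)
    (integrable_visitCount_div_sub hT.measurable hU n _).abs δ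

theorem tendsto_measureReal_lt_visitCount [IsProbabilityMeasure μ] (hT : Ergodic T μ)
    {U : Set Ω} (hU : MeasurableSet U) {m n : ℕ → ℕ} (hn : Tendsto n atTop atTop) {r : ℝ}
    (hr : Tendsto (fun j => (m j : ℝ) / n j) atTop (𝓝 r)) (hUr : μ.real U < r) :
    Tendsto (fun j => μ.real {x | m j < visitCount T U (n j) x}) atTop (𝓝 0) := by
  have hδ : 0 < (r - μ.real U) / 2 := by linarith
  refine squeeze_zero' (.of_forall fun _ => measureReal_nonneg) ?_
    ((tendsto_measureReal_le_abs_visitCount_div_sub hT hU hδ).comp hn)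
  filter_upwards [hr.eventually_const_lt (show (r + μ.real U) / 2 < r by linarith)] with j hj
  refine measureReal_mono fun x (hx : m j < _) => ?_
  have : (m j : ℝ) / n j ≤ (visitCount T U (n j) x : ℝ) / n j := by gcongr
  have hle := le_abs_self ((visitCount T U (n j) x : ℝ) / n j - μ.real U)
  simp only [mem_ofPred_eq]
  linarith

theorem tendsto_measureReal_visitCount_lt [IsProbabilityMeasure μ] (hT : Ergodic T μ)
    {U : Set Ω} (hU : MeasurableSet U) {m n : ℕ → ℕ} (hn : Tendsto n atTop atTop) {r : ℝ}
    (hr : Tendsto (fun j => (m j : ℝ) / n j) atTop (𝓝 r)) (hUr : r < μ.real U) :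
    Tendsto (fun j => μ.real {x | visitCount T U (n j) x < m j}) atTop (𝓝 0) := by
  have hδ : 0 < (μ.real U - r) / 2 := by linarith
  refine squeeze_zero' (.of_forall fun _ => measureReal_nonneg) ?_
    ((tendsto_measureReal_le_abs_visitCount_div_sub hT hU hδ).comp hn)
  filter_upwards [hr.eventually_lt_const (show r < (r + μ.real U) / 2 by linarith)] with j hj
  refine measureReal_mono fun x (hx : _ < m j) => ?_
  have : (visitCount T U (n j) x : ℝ) / n j ≤ (m j : ℝ) / n j := by gcongr
  have hle := neg_le_abs ((visitCount T U (n j) x : ℝ) / n j - μ.real U)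
  simp only [mem_ofPred_eq]
  linarith

/-! ### Asymptotic independence of `{τ_B > n}` and `U` -/

/-- The event `{τ_B > n}` is almost invariant: it differs from its preimage under `T` only by points
that enter `B` at time `1` or at time `n + 1`. -/
theorem abs_measureReal_inter_preimage_sub_le [IsFiniteMeasure μ] (hT : MeasurePreserving T μ μ)
    {B W : Set Ω} (hB : MeasurableSet B) (hW : MeasurableSet W) (n : ℕ) :
    |μ.real ({x | (n : ℕ∞) < entryTime T B x} ∩ T ⁻¹' W) -
      μ.real ({x | (n : ℕ∞) < entryTime T B x} ∩ W)| ≤ μ.real B := by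
  set V := {x | (n : ℕ∞) < entryTime T B x}
  have hVm : MeasurableSet V := measurableSet_natCast_lt_entryTime hT.measurable hB n
  have hpre : ∀ k, μ.real (T^[k] ⁻¹' B) = μ.real B := fun k =>
    (hT.iterate k).measureReal_preimage hB.nullMeasurableSet
  have hVW : μ.real (V ∩ W) = μ.real (T ⁻¹' V ∩ T ⁻¹' W) :=
    (hT.measureReal_preimage (hVm.inter hW).nullMeasurableSet).symm
  have h₁ : V ∩ T ⁻¹' W ⊆ (T ⁻¹' V ∩ T ⁻¹' W) ∪ T^[n + 1] ⁻¹' B := by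
    rintro x ⟨hxV, hxW⟩
    by_cases hx : T^[n + 1] x ∈ B
    · exact .inr hx
    refine .inl ⟨(natCast_lt_entryTime_iff T B (T x) n).2 fun k hk => ?_, hxW⟩
    rw [← Function.iterate_succ_apply]
    rcases (Nat.succ_le_of_lt hk).lt_or_eq with h | rfl
    · exact (natCast_lt_entryTime_iff T B x n).1 hxV (k + 1) h
    · exact hx
  have h₂ : T ⁻¹' V ∩ T ⁻¹' W ⊆ (V ∩ T ⁻¹' W) ∪ T^[1] ⁻¹' B := by
    rintro x ⟨hxV, hxW⟩
    by_cases hx : T^[1] x ∈ B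
    · exact .inr hx
    refine .inl ⟨(natCast_lt_entryTime_iff T B x n).2 fun k hk => ?_, hxW⟩
    cases k with
    | zero => exact hx
    | succ k =>
      rw [Function.iterate_succ_apply]
      exact (natCast_lt_entryTime_iff T B (T x) n).1 hxV k (by omega)
  have h₁' := (measureReal_mono (μ := μ) h₁).trans (measureReal_union_le _ _)
  have h₂' := (measureReal_mono (μ := μ) h₂).trans (measureReal_union_le _ _)
  rw [hpre] at h₁' h₂'
  rw [hVW, abs_le]
  constructor <;> linarith

theorem abs_measureReal_inter_preimage_iterate_sub_le [IsFiniteMeasure μ]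
    (hT : MeasurePreserving T μ μ) {B W : Set Ω} (hB : MeasurableSet B) (hW : MeasurableSet W)
    (n k : ℕ) :
    |μ.real ({x | (n : ℕ∞) < entryTime T B x} ∩ T^[k] ⁻¹' W) -
      μ.real ({x | (n : ℕ∞) < entryTime T B x} ∩ W)| ≤ k * μ.real B := by
  induction k with
  | zero => simp
  | succ k ih =>
    have h := abs_measureReal_inter_preimage_sub_le hT hB ((hT.measurable.iterate k) hW) n
    rw [← preimage_comp, ← Function.iterate_succ] at h
    refine (abs_sub_le _ _ _).trans ((add_le_add h ih).trans (le_of_eq ?_))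
    push_cast
    ring

/-- Quantitative asymptotic independence of `{τ_B > n}` and `U`, with a bound uniform in `n`:
`U` is replaced by the average of its first `K` preimages. -/
theorem abs_measureReal_inter_sub_mul_le [IsProbabilityMeasure μ] (hT : MeasurePreserving T μ μ)
    {U B : Set Ω} (hU : MeasurableSet U) (hB : MeasurableSet B) (n : ℕ) {K : ℕ} (hK : K ≠ 0) :
    |μ.real ({x | (n : ℕ∞) < entryTime T B x} ∩ U) -
        μ.real U * μ.real {x | (n : ℕ∞) < entryTime T B x}| ≤
      K * μ.real B + ∫ x, |(visitCount T U K x : ℝ) / K - μ.real U| ∂μ := by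
  have hK' : (0 : ℝ) < K := by positivity
  set V := {x | (n : ℕ∞) < entryTime T B x}
  have hVm : MeasurableSet V := measurableSet_natCast_lt_entryTime hT.measurable hB n
  have hint := integrable_visitCount_div_sub (μ := μ) hT.measurable hU K
  have hvis : ∀ x, (visitCount T U K x : ℝ) =
      ∑ k ∈ Finset.range K, (T^[k + 1] ⁻¹' U).indicator (1 : Ω → ℝ) x := fun x => by
    simp only [visitCount, birkhoffSum, Nat.cast_sum]
    refine Finset.sum_congr rfl fun k _ => ?_
    rw [← Function.iterate_succ_apply]
    by_cases h : T^[k + 1] x ∈ U <;> simp [h, -Function.iterate_succ]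
  have hmeas : ∀ k, MeasurableSet (T^[k + 1] ⁻¹' U) := fun k => hT.measurable.iterate (k + 1) hU
  have hsum : ∫ x in V, (visitCount T U K x : ℝ) / K ∂μ =
      (∑ k ∈ Finset.range K, μ.real (V ∩ T^[k + 1] ⁻¹' U)) / K := by
    simp only [integral_div, hvis]
    rw [integral_finsetSum _ fun k _ => show IntegrableOn ((T^[k + 1] ⁻¹' U).indicator 1) V μ from
      ((integrable_const (1 : ℝ)).indicator (hmeas k)).integrableOn]
    simp only [integral_indicator_one (hmeas _), measureReal_restrict_apply (hmeas _), inter_comm]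
  have h₁ : |(∑ k ∈ Finset.range K, μ.real (V ∩ T^[k + 1] ⁻¹' U)) / K - μ.real U * μ.real V| ≤
      ∫ x, |(visitCount T U K x : ℝ) / K - μ.real U| ∂μ := by
    have h0 : Integrable (fun x => (visitCount T U K x : ℝ) / K) μ := by simpa using hint 0
    rw [← hsum]
    calc _ = |∫ x in V, ((visitCount T U K x : ℝ) / K - μ.real U) ∂μ| := by
          rw [integral_sub h0.integrableOn (integrable_const _)]
          simp [mul_comm]
      _ ≤ ∫ x in V, |(visitCount T U K x : ℝ) / K - μ.real U| ∂μ := abs_integral_le_integral_abs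
      _ ≤ _ := setIntegral_le_integral (hint _).abs (ae_of_all _ fun _ => abs_nonneg _)
  have h₂ : |μ.real (V ∩ U) - (∑ k ∈ Finset.range K, μ.real (V ∩ T^[k + 1] ⁻¹' U)) / K| ≤
      K * μ.real B := by
    have : μ.real (V ∩ U) - (∑ k ∈ Finset.range K, μ.real (V ∩ T^[k + 1] ⁻¹' U)) / K =
        -((∑ k ∈ Finset.range K, (μ.real (V ∩ T^[k + 1] ⁻¹' U) - μ.real (V ∩ U))) / K) := by
      rw [Finset.sum_sub_distrib]
      simp
      field_simp
      ring
    rw [this, abs_neg, abs_div, abs_of_pos hK', div_le_iff₀ hK']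
    calc _ ≤ ∑ k ∈ Finset.range K, |μ.real (V ∩ T^[k + 1] ⁻¹' U) - μ.real (V ∩ U)| :=
          Finset.abs_sum_le_sum_abs _ _
      _ ≤ ∑ k ∈ Finset.range K, K * μ.real B := by
          refine Finset.sum_le_sum fun k hk =>
            (abs_measureReal_inter_preimage_iterate_sub_le hT hB hU n (k + 1)).trans ?_
          have : k + 1 ≤ K := Finset.mem_range.1 hk
          gcongr
      _ = _ := by simp; ring
  exact (abs_sub_le _ _ _).trans (add_le_add h₂ h₁)

theorem tendsto_measureReal_inter_sub_mul [IsProbabilityMeasure μ] (hT : Ergodic T μ)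
    {U : Set Ω} (hU : MeasurableSet U) {B : ℕ → Set Ω} (hB : ∀ j, MeasurableSet (B j))
    (hB_zero : Tendsto (fun j => μ.real (B j)) atTop (𝓝 0)) (n : ℕ → ℕ) :
    Tendsto (fun j => μ.real ({x | (n j : ℕ∞) < entryTime T (B j) x} ∩ U) -
        μ.real U * μ.real {x | (n j : ℕ∞) < entryTime T (B j) x}) atTop (𝓝 0) := by
  rw [Metric.tendsto_nhds]
  intro ε hε
  simp only [dist_zero_right, Real.norm_eq_abs]
  obtain ⟨K, hK, hK0⟩ := (((tendsto_integral_abs_visitCount_div_sub hT hU).eventually_lt_const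
    (half_pos hε)).and (eventually_ne_atTop 0)).exists
  have h : Tendsto (fun j => (K : ℝ) * μ.real (B j)) atTop (𝓝 0) := by
    simpa using hB_zero.const_mul (K : ℝ)
  filter_upwards [h.eventually_lt_const (half_pos hε)] with j hj
  have := abs_measureReal_inter_sub_mul_le hT.toMeasurePreserving hU (hB j) (n j) hK0
  linarith

/-! ### Comparison of the distributions -/

theorem entryTimeDist_eq (B : Set Ω) {t : ℝ} (ht : 0 ≤ t) :
    entryTimeDist T μ B t = μ.real {x | (⌊t / μ.real B⌋₊ : ℕ∞) < entryTime T B x} := by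
  simp only [entryTimeDist, ofReal_lt_entryTime_iff T B _ (div_nonneg ht measureReal_nonneg)]

theorem inducedMeasure_real_apply {U : Set Ω} (hU : MeasurableSet U) (A : Set U) :
    (inducedMeasure μ U).real A = μ.real ((↑) '' A : Set Ω) / μ.real U := by
  rw [inducedMeasure, measureReal_ennreal_smul_apply, measureReal_def (μ.comap _),
    (MeasurableEmbedding.subtype_coe hU).comap_apply, ENNReal.toReal_inv, div_eq_inv_mul]
  rfl

theorem inducedEntryTimeDist_eq {U B : Set Ω} (hU : MeasurableSet U) (hBU : B ⊆ U) {t : ℝ}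
    (ht : 0 ≤ t) :
    inducedEntryTimeDist T μ U B t = μ.real ((↑) '' {x : U | (⌊t / (μ.real B / μ.real U)⌋₊ : ℕ∞) <
      entryTime (inducedMap T U) ((↑) ⁻¹' B) x} : Set Ω) / μ.real U := by
  rw [inducedEntryTimeDist, entryTimeDist_eq _ ht, inducedMeasure_real_apply hU,
    inducedMeasure_real_apply hU, Subtype.image_preimage_coe, inter_eq_self_of_subset_right hBU]

theorem measureReal_lt_entryTime_le_add [IsFiniteMeasure μ] (hT : MeasurePreserving T μ μ)
    {B : Set Ω} (hB : MeasurableSet B) (n p : ℕ) :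
    μ.real {x | (n : ℕ∞) < entryTime T B x} ≤
      μ.real {x | ((n + p : ℕ) : ℕ∞) < entryTime T B x} + p * μ.real B := by
  induction p with
  | zero => simp
  | succ p ih =>
    have hsub : {x | ((n + p : ℕ) : ℕ∞) < entryTime T B x} ⊆
        {x | ((n + (p + 1) : ℕ) : ℕ∞) < entryTime T B x} ∪ T^[n + p + 1] ⁻¹' B := by
      intro x hx
      by_cases hxB : T^[n + p + 1] x ∈ B
      · exact .inr hxB
      · refine .inl ((natCast_lt_entryTime_iff T B x _).2 fun k hk => ?_)
        rcases (Nat.le_of_lt_succ hk).lt_or_eq with h | rfl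
        · exact (natCast_lt_entryTime_iff T B x _).1 hx k h
        · exact hxB
    have h := (measureReal_mono (μ := μ) hsub).trans (measureReal_union_le _ _)
    rw [(hT.iterate _).measureReal_preimage hB.nullMeasurableSet] at h
    push_cast at h ih ⊢
    linarith

/-- The entry times distributions are `1`-Lipschitz up to an error `μ(B)`. -/
theorem entryTimeDist_le_add [IsFiniteMeasure μ] (hT : MeasurePreserving T μ μ)
    {B : Set Ω} (hB : MeasurableSet B) (hB_pos : 0 < μ.real B) {s t : ℝ} (hs : 0 ≤ s)
    (hst : s ≤ t) :
    entryTimeDist T μ B s ≤ entryTimeDist T μ B t + (t - s + μ.real B) := by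
  rw [entryTimeDist_eq B hs, entryTimeDist_eq B (hs.trans hst)]
  have hle : ⌊s / μ.real B⌋₊ ≤ ⌊t / μ.real B⌋₊ := by gcongr
  obtain ⟨p, hp⟩ := Nat.exists_eq_add_of_le hle
  have h := measureReal_lt_entryTime_le_add hT hB ⌊s / μ.real B⌋₊ p
  have h₁ : s / μ.real B < ⌊s / μ.real B⌋₊ + 1 := Nat.lt_floor_add_one _
  have h₂ : (⌊t / μ.real B⌋₊ : ℝ) ≤ t / μ.real B :=
    Nat.floor_le (div_nonneg (hs.trans hst) hB_pos.le)
  rw [← hp] at h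
  refine h.trans ?_
  gcongr
  have h₃ : (p : ℝ) ≤ t / μ.real B - s / μ.real B + 1 := by
    rw [hp] at h₂
    push_cast at h₂
    linarith
  calc (p : ℝ) * μ.real B ≤ (t / μ.real B - s / μ.real B + 1) * μ.real B := by gcongr
    _ = t - s + μ.real B := by field_simp

theorem tendsto_natFloor_div_mul {b : ℕ → ℝ} (hb_pos : ∀ j, 0 < b j)
    (hb : Tendsto b atTop (𝓝 0)) {s : ℝ} (hs : 0 < s) :
    Tendsto (fun j => (⌊s / b j⌋₊ : ℝ) * b j) atTop (𝓝 s) := by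
  have hinv : Tendsto (fun j => (b j)⁻¹) atTop atTop :=
    tendsto_inv_nhdsGT_zero.comp (tendsto_nhdsWithin_iff.2 ⟨hb, .of_forall hb_pos⟩)
  refine ((tendsto_nat_floor_mul_div_atTop hs.le).comp hinv).congr fun j => ?_
  simp [div_eq_mul_inv]

theorem tendsto_natFloor_div_atTop {b : ℕ → ℝ} (hb_pos : ∀ j, 0 < b j)
    (hb : Tendsto b atTop (𝓝 0)) {s : ℝ} (hs : 0 < s) :
    Tendsto (fun j => ⌊s / b j⌋₊) atTop atTop := by
  have hinv : Tendsto (fun j => (b j)⁻¹) atTop atTop :=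
    tendsto_inv_nhdsGT_zero.comp (tendsto_nhdsWithin_iff.2 ⟨hb, .of_forall hb_pos⟩)
  exact tendsto_nat_floor_atTop.comp (hinv.const_mul_atTop hs)

theorem tendsto_natFloor_div_natFloor {b : ℕ → ℝ} (hb_pos : ∀ j, 0 < b j)
    (hb : Tendsto b atTop (𝓝 0)) {s t u : ℝ} (hs : 0 < s) (ht : 0 < t) (hu : 0 < u) :
    Tendsto (fun j => (⌊t / (b j / u)⌋₊ : ℝ) / ⌊s / b j⌋₊) atTop (𝓝 (u * (t / s))) := by
  have h := (tendsto_natFloor_div_mul hb_pos hb (mul_pos ht hu)).div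
    (tendsto_natFloor_div_mul hb_pos hb hs) hs.ne'
  rw [mul_comm t u, mul_div_assoc] at h
  refine h.congr fun j => ?_
  rw [Pi.div_apply, mul_div_mul_right _ _ (hb_pos j).ne', div_div_eq_mul_div, mul_comm t u]

/-- The distributions of the original and of the induced system differ by a null sequence. -/
theorem tendsto_inducedEntryTimeDist_sub_entryTimeDist [IsProbabilityMeasure μ]
    (hT : Ergodic T μ) {U : Set Ω} (hU : MeasurableSet U) (hU_pos : 0 < μ.real U)
    {B : ℕ → Set Ω} (hB : ∀ j, MeasurableSet (B j)) (hBU : ∀ j, B j ⊆ U)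
    (hB_pos : ∀ j, 0 < μ.real (B j)) (hB_zero : Tendsto (fun j => μ.real (B j)) atTop (𝓝 0))
    {t : ℝ} (ht : 0 < t) :
    Tendsto (fun j => inducedEntryTimeDist T μ U (B j) t - entryTimeDist T μ (B j) t) atTop
      (𝓝 0) := by
  -- For `s < t`, off a small set `S_n ≤ m`, so `τ̂_B > m` forces `τ_B > n`.
  have hUpper : ∀ s, 0 < s → s < t → ∀ ε > 0, ∀ᶠ j in atTop,
      inducedEntryTimeDist T μ U (B j) t ≤ entryTimeDist T μ (B j) s + ε := by
    intro s hs hst ε hε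
    have hbad := tendsto_measureReal_lt_visitCount hT hU
      (tendsto_natFloor_div_atTop hB_pos hB_zero hs)
      (tendsto_natFloor_div_natFloor hB_pos hB_zero hs ht hU_pos)
      (lt_mul_of_one_lt_right hU_pos ((one_lt_div hs).2 hst))
    have hmix := tendsto_measureReal_inter_sub_mul hT hU hB hB_zero fun j => ⌊s / μ.real (B j)⌋₊
    have hsum := hbad.add hmix
    rw [add_zero] at hsum
    filter_upwards [hsum.eventually_lt_const (mul_pos hε hU_pos)] with j hj
    rw [inducedEntryTimeDist_eq hU (hBU j) ht.le, entryTimeDist_eq _ hs.le, div_le_iff₀ hU_pos]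
    set n := ⌊s / μ.real (B j)⌋₊
    set m := ⌊t / (μ.real (B j) / μ.real U)⌋₊
    have hsub : ((↑) '' {x : U | (m : ℕ∞) < entryTime (inducedMap T U) ((↑) ⁻¹' B j) x} : Set Ω) ⊆
        ({x | (n : ℕ∞) < entryTime T (B j) x} ∩ U) ∪ {x | m < visitCount T U n x} := by
      rintro _ ⟨x, hx, rfl⟩
      by_cases hv : m < visitCount T U n x
      · exact .inr hv
      · refine .inl ⟨(natCast_lt_entryTime_iff_visitCount_lt (hBU j) x n).2 (lt_of_le_of_lt ?_ hx),
          x.2⟩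
        exact_mod_cast not_lt.1 hv
    have h := (measureReal_mono (μ := μ) hsub).trans (measureReal_union_le _ _)
    linarith
  -- For `s > t`, off a small set `m ≤ S_n`, so `τ_B > n` forces `τ̂_B > m`.
  have hLower : ∀ s, t < s → ∀ ε > 0, ∀ᶠ j in atTop,
      entryTimeDist T μ (B j) s ≤ inducedEntryTimeDist T μ U (B j) t + ε := by
    intro s hst ε hε
    have hs := ht.trans hst
    have hbad := tendsto_measureReal_visitCount_lt hT hU
      (tendsto_natFloor_div_atTop hB_pos hB_zero hs)
      (tendsto_natFloor_div_natFloor hB_pos hB_zero hs ht hU_pos)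
      (mul_lt_of_lt_one_right hU_pos ((div_lt_one hs).2 hst))
    have hmix := tendsto_measureReal_inter_sub_mul hT hU hB hB_zero fun j => ⌊s / μ.real (B j)⌋₊
    have hsum := hbad.sub hmix
    rw [sub_zero] at hsum
    filter_upwards [hsum.eventually_lt_const (mul_pos hε hU_pos)] with j hj
    rw [inducedEntryTimeDist_eq hU (hBU j) ht.le, entryTimeDist_eq _ hs.le, ← sub_le_iff_le_add,
      le_div_iff₀ hU_pos]
    set n := ⌊s / μ.real (B j)⌋₊
    set m := ⌊t / (μ.real (B j) / μ.real U)⌋₊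
    have hsub : {x | (n : ℕ∞) < entryTime T (B j) x} ∩ U ⊆
        ((↑) '' {x : U | (m : ℕ∞) < entryTime (inducedMap T U) ((↑) ⁻¹' B j) x} : Set Ω) ∪
          {x | visitCount T U n x < m} := by
      rintro x ⟨hx, hxU⟩
      by_cases hv : visitCount T U n x < m
      · exact .inr hv
      · refine .inl ⟨⟨x, hxU⟩, lt_of_le_of_lt ?_
          ((natCast_lt_entryTime_iff_visitCount_lt (hBU j) ⟨x, hxU⟩ n).1 hx), rfl⟩
        exact_mod_cast not_lt.1 hv
    have h := (measureReal_mono (μ := μ) hsub).trans (measureReal_union_le _ _)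
    linarith
  rw [Metric.tendsto_nhds]
  intro ε hε
  simp only [dist_zero_right, Real.norm_eq_abs, abs_lt]
  -- `δ ≤ ε / 4` bounds the error of moving `t ± δ` to `t`; `δ ≤ t / 2` keeps `t - δ` positive.
  set δ := min (ε / 4) (t / 2)
  have hδ : 0 < δ := lt_min (by linarith) (by linarith)
  have hδε : δ ≤ ε / 4 := min_le_left _ _
  have hδt : δ ≤ t / 2 := min_le_right _ _
  filter_upwards [hUpper (t - δ) (by linarith) (by linarith) _ (div_pos hε four_pos),
    hLower (t + δ) (by linarith) _ (div_pos hε four_pos),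
    hB_zero.eventually_lt_const (div_pos hε four_pos)] with j h₁ h₂ h₃
  have h₄ := entryTimeDist_le_add hT.toMeasurePreserving (hB j) (hB_pos j)
    (show 0 ≤ t - δ by linarith) (show t - δ ≤ t by linarith)
  have h₅ := entryTimeDist_le_add hT.toMeasurePreserving (hB j) (hB_pos j)
    ht.le (show t ≤ t + δ by linarith)
  constructor <;> linarith

end EntryTimes

theorem theorem1 {Ω : Type*} [MeasurableSpace Ω] (μ : Measure Ω) [IsProbabilityMeasure μ]
    (T : Ω → Ω) (hT : Ergodic T μ)
    (U : Set Ω) (hU : MeasurableSet U) (hU_pos : 0 < μ U)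
    (B : ℕ → Set Ω) (hB : ∀ j, MeasurableSet (B j)) (hBU : ∀ j, B j ⊆ U)
    (hB_pos : ∀ j, 0 < μ (B j)) (hB_zero : Tendsto (fun j => μ (B j)) atTop (𝓝 0)) :
    ((∃ F : ℝ → ℝ, ∀ t : ℝ, 0 < t →
        Tendsto (fun j => entryTimeDist T μ (B j) t) atTop (𝓝 (F t))) ↔
      (∃ F' : ℝ → ℝ, ∀ t : ℝ, 0 < t →
        Tendsto (fun j => inducedEntryTimeDist T μ U (B j) t) atTop (𝓝 (F' t)))) ∧
    (∀ F F' : ℝ → ℝ,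
      (∀ t : ℝ, 0 < t →
        Tendsto (fun j => entryTimeDist T μ (B j) t) atTop (𝓝 (F t))) →
      (∀ t : ℝ, 0 < t →
        Tendsto (fun j => inducedEntryTimeDist T μ U (B j) t) atTop (𝓝 (F' t))) →
      ∀ t : ℝ, 0 < t → F t = F' t) := by
  have hzero : Tendsto (fun j => μ.real (B j)) atTop (𝓝 0) :=
    (ENNReal.tendsto_toReal_zero_iff fun j => measure_ne_top μ (B j)).2 hB_zero
  have hdiff : ∀ t : ℝ, 0 < t → Tendsto (fun j => inducedEntryTimeDist T μ U (B j) t -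
      entryTimeDist T μ (B j) t) atTop (𝓝 0) := fun t ht =>
    tendsto_inducedEntryTimeDist_sub_entryTimeDist hT hU
      (ENNReal.toReal_pos hU_pos.ne' (measure_ne_top μ U)) hB hBU
      (fun j => ENNReal.toReal_pos (hB_pos j).ne' (measure_ne_top μ _)) hzero ht
  refine ⟨⟨?_, ?_⟩, ?_⟩
  · rintro ⟨F, hF⟩
    exact ⟨F, fun t ht => by simpa using (hF t ht).add (hdiff t ht)⟩
  · rintro ⟨F', hF'⟩
    exact ⟨F', fun t ht => by simpa using (hF' t ht).sub (hdiff t ht)⟩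
  · intro F F' hF hF' t ht
    refine tendsto_nhds_unique (hF t ht) ?_
    simpa using (hF' t ht).sub (hdiff t ht)
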